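/- Let $H$ be a real or complex Hilbert space with orthonormal basis $(e_n)_{n\ge 0}$. Let $\omega\in(0,1)$, let $(m_k)_{k\ge0}$ be a bounded sequence of positive integers, and let $(a_j)_{j\ge1}$, $(b_j)_{j\ge1}$ be real sequences with $0<a_1\le a_2\le\cdots$ and $\inf_j b_j>0$. Put $r_k=m_0+\cdots+m_{k-1}$ (so $r_0=0$), let $k(n)$ be the index with $r_{k(n)}\le n<r_{k(n)+1}$, and for $j\ge 1$ let $$H_{a_j,b_j}=\Big\{f\in H:\ \|f\|_{H_{a_j,b_j}}^2=\sum_{n\ge0}\omega^{-a_j k(n)^{b_j}}|\langle f,e_n\rangle|^2<\infty\Big\}.$$ For $s\ge1$ let $H_s=H\otimes\cdots\otimes H$ ($s$ factors), let $H_{s,\mathbf a,\mathbf b}=H_{a_1,b_1}\otimes\cdots\otimes H_{a_s,b_s}$ (Hilbert tensor products), and let $\mathrm{APP}_s:H_{s,\mathbf a,\mathbf b}\to H_s$ be the embedding. For $n\ge 0$ let $e(n,\mathrm{APP}_s)=\inf\|\mathrm{APP}_s-A_n\|$, the infimum over all algorithms $A_nf=\sum_{i=1}^nL_i(f)g_i$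 with $L_i\in H_{s,\mathbf a,\mathbf b}^*$ and $g_i\in H_s$, and let $n(\varepsilon,\mathrm{APP}_s)=\min\{n: e(n,\mathrm{APP}_s)\le\varepsilon\}$. The problem $\mathrm{APP}=(\mathrm{APP}_s)_{s\ge1}$ is called EC-quasi-polynomially tractable (EC-QPT) if there are $C,t>0$ with $$n(\varepsilon,\mathrm{APP}_s)\le C\exp\big(t(1+\log s)(1+\log(1+\log\varepsilon^{-1}))\big)\qquad\text{for all } s\ge 1,\ \varepsilon\in(0,1),$$ and the infimum $t^*$ of all $t>0$ for which this bound holds for some $C>0$ is called the exponent of EC-QPT. **Theorem.** $\mathrm{APP}$ is EC-QPT if and only if $$m_0=1,\qquad B^*:=\sup_{s\ge1}\frac{\sum_{j=1}^s b_j^{-1}}{1+\log s}<\infty\qquad\text{and}\qquad \alpha:=\liminf_{j\to\infty}\frac{(1+\log j)\,\log a_j}{j}>0 .$$ If this holds, then, with $m_{\max}=\max_{k\ge1}m_k$, $$t^*\in\Big[\max\Big(B^*,\frac{\log(1+m_1)}{\alpha}\Big),\ B^*+\frac{\log(1+m_{\max})}{\alpha}\Big],$$ where $c/\alpha=0$ if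 $\alpha=\infty$. In particular, $t^*=B^*$ if $\alpha=\infty$. -/

import Mathlib

open scoped TensorProduct InnerProductSpace

noncomputable section

namespace ECTract

universe u v

/-! ### Hilbert spaces and their (completed) tensor products -/

/-- A Hilbert space over `𝕜`, bundled, so that tensor products can be formed recursively. -/
structure HilbertSpace (𝕜 : Type u) [RCLike 𝕜] where
  carrier : Type v
  [normedAddCommGroup : NormedAddCommGroup carrier]
  [innerProductSpace : InnerProductSpace 𝕜 carrier]
  [completeSpace : CompleteSpace carrier]

attribute [instance] HilbertSpace.normedAddCommGroup HilbertSpace.innerProductSpace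
  HilbertSpace.completeSpace

namespace HilbertSpace

variable {𝕜 : Type u} [RCLike 𝕜]

/-- The Hilbert tensor product of two Hilbert spaces: the completion of the algebraic tensor
product for the inner product with `⟪x ⊗ y, x' ⊗ y'⟫ = ⟪x, x'⟫ * ⟪y, y'⟫`. -/
def tensor (E F : HilbertSpace.{u, v} 𝕜) : HilbertSpace.{u, v} 𝕜 where
  carrier := UniformSpace.Completion (E.carrier ⊗[𝕜] F.carrier)

/-- The Hilbert tensor product `S ⊗ T` of two bounded operators: the continuous extension of the
operator with `x ⊗ y ↦ S x ⊗ T y`. -/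
def tensorMap {E E' F F' : HilbertSpace.{u, v} 𝕜}
    (S : E.carrier →L[𝕜] E'.carrier) (T : F.carrier →L[𝕜] F'.carrier) :
    (E.tensor F).carrier →L[𝕜] (E'.tensor F').carrier :=
  ((UniformSpace.Completion.toComplL (𝕜 := 𝕜) (E := E'.carrier ⊗[𝕜] F'.carrier)).comp
      (TensorProduct.mapL S T)).extend
    (UniformSpace.Completion.toComplL (𝕜 := 𝕜) (E := E.carrier ⊗[𝕜] F.carrier))

theorem tensorMap_coe {E E' F F' : HilbertSpace.{u, v} 𝕜}
    (S : E.carrier →L[𝕜] E'.carrier) (T : F.carrier →L[𝕜] F'.carrier)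
    (x : E.carrier) (y : F.carrier) :
    tensorMap S T ((x ⊗ₜ[𝕜] y : E.carrier ⊗[𝕜] F.carrier) :
        UniformSpace.Completion (E.carrier ⊗[𝕜] F.carrier)) =
      ((S x ⊗ₜ[𝕜] T y : E'.carrier ⊗[𝕜] F'.carrier) :
        UniformSpace.Completion (E'.carrier ⊗[𝕜] F'.carrier)) :=
  ContinuousLinearMap.extend_eq
    (F := UniformSpace.Completion (E'.carrier ⊗[𝕜] F'.carrier))
    ((UniformSpace.Completion.toComplL (𝕜 := 𝕜) (E := E'.carrier ⊗[𝕜] F'.carrier)).comp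
      (TensorProduct.mapL S T))
    (e := UniformSpace.Completion.toComplL (𝕜 := 𝕜) (E := E.carrier ⊗[𝕜] F.carrier))
    UniformSpace.Completion.denseRange_coe
    (UniformSpace.Completion.isUniformInducing_coe _) (x ⊗ₜ[𝕜] y)

/-- `tensorSeq E n` is the Hilbert tensor product `E 0 ⊗ E 1 ⊗ ⋯ ⊗ E n` of `n + 1` factors. -/
def tensorSeq (E : ℕ → HilbertSpace.{u, v} 𝕜) : ℕ → HilbertSpace.{u, v} 𝕜
  | 0 => E 0
  | n + 1 => (tensorSeq E n).tensor (E (n + 1))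

/-- `tensorSeqMap T n` is the operator `T 0 ⊗ T 1 ⊗ ⋯ ⊗ T n`. -/
def tensorSeqMap {E F : ℕ → HilbertSpace.{u, v} 𝕜} (T : ∀ j, (E j).carrier →L[𝕜] (F j).carrier) :
    ∀ n, (tensorSeq E n).carrier →L[𝕜] (tensorSeq F n).carrier
  | 0 => T 0
  | n + 1 => tensorMap (tensorSeqMap T n) (T (n + 1))

end HilbertSpace

/-! ### Minimal worst case errors and information complexity -/

section Complexity

variable {𝕜 F G : Type*} [RCLike 𝕜] [NormedAddCommGroup F] [InnerProductSpace 𝕜 F]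
  [NormedAddCommGroup G] [InnerProductSpace 𝕜 G]

/-- The linear algorithm `f ↦ ∑ j, L j f • g j` which uses the `n` continuous linear functionals
`L j`. -/
def linearAlgorithm {n : ℕ} (L : Fin n → F →L[𝕜] 𝕜) (g : Fin n → G) : F →L[𝕜] G :=
  ∑ j, (L j).smulRight (g j)

/-- The `n`th minimal worst case error `e(n, T)`: the infimum of the worst case errors
`‖T - A‖ = sup_{‖f‖ ≤ 1} ‖T f - A f‖` of the algorithms `A` using `n` continuous linear
functionals. -/
def minimalError (T : F →L[𝕜] G) (n : ℕ) : ℝ :=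
  ⨅ A : (Fin n → F →L[𝕜] 𝕜) × (Fin n → G), ‖T - linearAlgorithm A.1 A.2‖

/-- The information complexity `n(ε, T)`: the least `n` with `e(n, T) ≤ ε` (and `⊤` if there is no
such `n`). -/
def infoComplexity (T : F →L[𝕜] G) (ε : ℝ) : ℕ∞ :=
  ⨅ (n : ℕ) (_ : minimalError T n ≤ ε), (n : ℕ∞)

end Complexity

/-! ### The weighted spaces -/

/-- The parameters `ω, m, a, b` with their standing assumptions. -/
structure Params where
  ω : ℝ
  ω_pos : 0 < ω
  ω_lt_one : ω < 1
  m : ℕ → ℕ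
  m_pos : ∀ k, 0 < m k
  m_bounded : ∃ M, ∀ k, m k ≤ M
  a : ℕ+ → ℝ
  a_one_pos : 0 < a 1
  a_mono : Monotone a
  b : ℕ+ → ℝ
  b_bounded_below : ∃ β, 0 < β ∧ ∀ j, β ≤ b j

namespace Params

variable (P : Params)

/-- `r k = m 0 + ⋯ + m (k - 1)`. -/
def r (k : ℕ) : ℕ := ∑ i ∈ Finset.range k, P.m i

/-- `block n` is the index `k` with `r k ≤ n < r (k + 1)`, i.e. the largest `k` with `r k ≤ n`
(note that `k ≤ r k`). -/
def block (n : ℕ) : ℕ := Nat.findGreatest (fun k => P.r k ≤ n) n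

theorem block_spec (n : ℕ) : P.r (P.block n) ≤ n ∧ n < P.r (P.block n + 1) := by
  have hr : ∀ k, k ≤ P.r k := fun k => by
    simpa [r] using Finset.card_nsmul_le_sum (Finset.range k) P.m 1 fun i _ => P.m_pos i
  refine ⟨Nat.findGreatest_spec (P := fun k => P.r k ≤ n) (Nat.zero_le n) (by simp [r]), ?_⟩
  by_contra! h
  have := Nat.le_findGreatest (P := fun k => P.r k ≤ n) ((hr _).trans h) h
  unfold block at this
  omega

/-- The weight `ω ^ (-a_j * k ^ b_j)` of the `n`th coefficient in the `j`th space, `k = block n`. -/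
def weight (j : ℕ+) (n : ℕ) : ℝ := P.ω ^ (-(P.a j * (P.block n : ℝ) ^ P.b j))

theorem a_pos (j : ℕ+) : 0 < P.a j := P.a_one_pos.trans_le (P.a_mono (one_le))

theorem one_le_weight (j : ℕ+) (n : ℕ) : 1 ≤ P.weight j n := by
  unfold weight
  refine Real.one_le_rpow_of_pos_of_le_one_of_nonpos P.ω_pos P.ω_lt_one.le ?_
  have := (P.a_pos j).le
  have h2 : (0 : ℝ) ≤ (P.block n : ℝ) ^ P.b j := by positivity
  nlinarith [mul_nonneg this h2]

theorem weight_pos (j : ℕ+) (n : ℕ) : 0 < P.weight j n :=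
  zero_lt_one.trans_le (P.one_le_weight j n)

end Params

section Weighted

variable {𝕜 H : Type*} [RCLike 𝕜] [NormedAddCommGroup H] [InnerProductSpace 𝕜 H]

theorem summable_weighted_inner (P : Params) (e : HilbertBasis ℕ 𝕜 H) (j : ℕ+) {f g : H}
    (hf : Summable fun n => P.weight j n * ‖⟪e n, f⟫_𝕜‖ ^ 2)
    (hg : Summable fun n => P.weight j n * ‖⟪e n, g⟫_𝕜‖ ^ 2) :
    Summable fun n => (P.weight j n : 𝕜) * ⟪⟪e n, f⟫_𝕜, ⟪e n, g⟫_𝕜⟫_𝕜 := by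
  refine Summable.of_norm_bounded (hf.add hg) fun n => ?_
  have hw := (P.weight_pos j n).le
  rw [norm_mul, RCLike.norm_ofReal, abs_of_nonneg hw, ← mul_add]
  refine mul_le_mul_of_nonneg_left ((norm_inner_le_norm _ _).trans ?_) hw
  nlinarith [sq_nonneg (‖⟪e n, f⟫_𝕜‖ - ‖⟪e n, g⟫_𝕜‖), sq_nonneg (‖⟪e n, f⟫_𝕜‖),
    sq_nonneg (‖⟪e n, g⟫_𝕜‖)]

/-- The vectors `f ∈ H` with `∑ n, weight j n * |⟨f, e n⟩| ^ 2 < ∞`. -/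
def weightedSubmodule (P : Params) (e : HilbertBasis ℕ 𝕜 H) (j : ℕ+) : Submodule 𝕜 H where
  carrier := {f | Summable fun n => P.weight j n * ‖⟪e n, f⟫_𝕜‖ ^ 2}
  zero_mem' := by simp [summable_zero]
  add_mem' {f g} hf hg := by
    refine Summable.of_nonneg_of_le (fun n => by have := P.weight_pos j n; positivity)
      (fun n => ?_) ((Summable.add hf hg).mul_left 2)
    have h := norm_add_le ⟪e n, f⟫_𝕜 ⟪e n, g⟫_𝕜
    have h2 : ‖⟪e n, f + g⟫_𝕜‖ ^ 2 ≤ 2 * (‖⟪e n, f⟫_𝕜‖ ^ 2 + ‖⟪e n, g⟫_𝕜‖ ^ 2) := by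
      rw [inner_add_right]
      nlinarith [sq_nonneg (‖⟪e n, f⟫_𝕜‖ - ‖⟪e n, g⟫_𝕜‖), norm_nonneg (⟪e n, f⟫_𝕜 + ⟪e n, g⟫_𝕜)]
    nlinarith [mul_le_mul_of_nonneg_left h2 (P.weight_pos j n).le]
  smul_mem' c f hf := by
    refine (Summable.mul_left (‖c‖ ^ 2) hf).congr fun n => ?_
    rw [inner_smul_right, norm_mul]; ring

/-- The weighted space `H_{a_j, b_j}`: the subspace `weightedSubmodule P e j` of `H`, which is
given its own inner product `⟪f, g⟫ = ∑ n, weight j n * ⟪f, e n⟫ * ⟪e n, g⟫` below. -/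
def WeightedSpace (P : Params) (e : HilbertBasis ℕ 𝕜 H) (j : ℕ+) : Type _ :=
  weightedSubmodule P e j

namespace WeightedSpace

variable (P : Params) (e : HilbertBasis ℕ 𝕜 H) (j : ℕ+)

instance : AddCommGroup (WeightedSpace P e j) :=
  inferInstanceAs (AddCommGroup (weightedSubmodule P e j))

instance : Module 𝕜 (WeightedSpace P e j) :=
  inferInstanceAs (Module 𝕜 (weightedSubmodule P e j))

/-- The inclusion of the weighted space in `H`, as a linear map. -/
def incl : WeightedSpace P e j →ₗ[𝕜] H := (weightedSubmodule P e j).subtype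

variable {P e j} in
theorem incl_injective : Function.Injective (incl P e j) := Subtype.val_injective

variable {P e j} in
theorem summable (f : WeightedSpace P e j) :
    Summable fun n => P.weight j n * ‖⟪e n, incl P e j f⟫_𝕜‖ ^ 2 := f.2

variable {P e j} in
/-- The inner product of the weighted space. -/
def ip (f g : WeightedSpace P e j) : 𝕜 :=
  ∑' n, (P.weight j n : 𝕜) * ⟪⟪e n, incl P e j f⟫_𝕜, ⟪e n, incl P e j g⟫_𝕜⟫_𝕜

variable {P e j} in
theorem ip_self_eq (f : WeightedSpace P e j) :
    ip f f = ((∑' n, P.weight j n * ‖⟪e n, incl P e j f⟫_𝕜‖ ^ 2 : ℝ) : 𝕜) := by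
  rw [ip, RCLike.ofReal_tsum]
  refine tsum_congr fun n => ?_
  rw [inner_self_eq_norm_sq_to_K]
  push_cast
  ring

variable {P e j} in
theorem summable_inner (f g : WeightedSpace P e j) :
    Summable fun n =>
      (P.weight j n : 𝕜) * ⟪⟪e n, incl P e j f⟫_𝕜, ⟪e n, incl P e j g⟫_𝕜⟫_𝕜 :=
  summable_weighted_inner P e j f.summable g.summable

/-- On the weighted space, `‖f‖_H ^ 2 ≤ ∑ n, weight j n * |⟨f, e n⟩| ^ 2`. -/
theorem norm_incl_sq_le (f : WeightedSpace P e j) :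
    ‖incl P e j f‖ ^ 2 ≤ ∑' n, P.weight j n * ‖⟪e n, incl P e j f⟫_𝕜‖ ^ 2 := by
  have h : HasSum (fun n => ‖e.repr (incl P e j f) n‖ ^ 2) (‖incl P e j f‖ ^ 2) := by
    have := lp.hasSum_norm (p := 2) (by norm_num) (e.repr (incl P e j f))
    simpa using this
  rw [← h.tsum_eq]
  refine h.summable.tsum_le_tsum (fun n => ?_) f.summable
  rw [e.repr_apply_apply]
  exact le_mul_of_one_le_left (sq_nonneg _) (P.one_le_weight j n)

/-- The inner product space structure of the weighted space. -/
@[reducible] def core : InnerProductSpace.Core 𝕜 (WeightedSpace P e j) where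
  inner := ip
  conj_inner_symm f g := by
    rw [ip, ip, RCLike.conj_tsum]
    refine tsum_congr fun n => ?_
    rw [map_mul, RCLike.conj_ofReal, inner_conj_symm]
  re_inner_nonneg f := by
    rw [ip_self_eq, RCLike.ofReal_re]
    exact tsum_nonneg fun n => mul_nonneg (P.weight_pos j n).le (sq_nonneg _)
  add_left f g h := by
    rw [ip, ip, ip, ← (summable_inner f h).tsum_add (summable_inner g h)]
    refine tsum_congr fun n => ?_
    rw [map_add, inner_add_right, inner_add_left, mul_add]
  smul_left f g c := by
    rw [ip, ip, ← tsum_mul_left]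
    refine tsum_congr fun n => ?_
    rw [map_smul, inner_smul_right, ← smul_eq_mul (a := c), inner_smul_left]
    ring
  definite f hf := by
    rw [ip_self_eq, RCLike.ofReal_eq_zero] at hf
    have h := norm_incl_sq_le P e j f
    rw [hf] at h
    have h0 : incl P e j f = 0 := by
      rw [← norm_eq_zero]
      nlinarith [norm_nonneg (incl P e j f)]
    exact incl_injective (by rw [h0, map_zero])

instance : NormedAddCommGroup (WeightedSpace P e j) := (core P e j).toNormedAddCommGroup

instance : InnerProductSpace 𝕜 (WeightedSpace P e j) := InnerProductSpace.ofCore _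

theorem inner_eq (f g : WeightedSpace P e j) :
    ⟪f, g⟫_𝕜 =
      ∑' n, (P.weight j n : 𝕜) * ⟪⟪e n, incl P e j f⟫_𝕜, ⟪e n, incl P e j g⟫_𝕜⟫_𝕜 := rfl

theorem norm_sq_eq (f : WeightedSpace P e j) :
    ‖f‖ ^ 2 = ∑' n, P.weight j n * ‖⟪e n, incl P e j f⟫_𝕜‖ ^ 2 := by
  have h := congrArg RCLike.re (ip_self_eq f)
  rw [RCLike.ofReal_re] at h
  exact (inner_self_eq_norm_sq (𝕜 := 𝕜) f).symm.trans h

/-- The univariate approximation problem: the embedding of the weighted space in `H`. -/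
def embed : WeightedSpace P e j →L[𝕜] H :=
  (incl P e j).mkContinuous 1 fun f => by
    rw [one_mul]
    refine le_of_sq_le_sq ?_ (norm_nonneg f)
    rw [norm_sq_eq]
    exact norm_incl_sq_le P e j f

/-- The weighted space is isometric to `ℓ²`, through `f ↦ (√(weight j n) * ⟪e n, f⟫)_n`. -/
def coords : WeightedSpace P e j →ₗᵢ[𝕜] lp (fun _ : ℕ => 𝕜) 2 where
  toFun f := ⟨fun n => (√(P.weight j n) : 𝕜) * ⟪e n, incl P e j f⟫_𝕜, by
    refine memℓp_gen (f.summable.congr fun n => ?_)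
    rw [norm_mul, RCLike.norm_ofReal, abs_of_nonneg (Real.sqrt_nonneg _)]
    norm_num
    rw [mul_pow, Real.sq_sqrt (P.weight_pos j n).le]⟩
  map_add' f g := by
    ext n
    simp only [map_add, inner_add_right, mul_add, lp.coeFn_add, Pi.add_apply]
  map_smul' c f := by
    ext n
    simp only [map_smul, inner_smul_right, lp.coeFn_smul, Pi.smul_apply, smul_eq_mul,
      RingHom.id_apply]
    ring
  norm_map' f := by
    rw [← sq_eq_sq₀ (norm_nonneg _) (norm_nonneg _), norm_sq_eq, ← Real.rpow_natCast]
    refine (lp.norm_rpow_eq_tsum (p := 2) (E := fun _ : ℕ => 𝕜) (by norm_num) _).trans ?_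
    refine tsum_congr fun n => ?_
    norm_num
    rw [abs_of_nonneg (Real.sqrt_nonneg _), mul_pow,
      Real.sq_sqrt (P.weight_pos j n).le]

theorem coords_apply (f : WeightedSpace P e j) (n : ℕ) :
    coords P e j f n = (√(P.weight j n) : 𝕜) * ⟪e n, incl P e j f⟫_𝕜 := rfl

theorem coords_surjective : Function.Surjective (coords P e j) := by
  intro c
  have hw : ∀ n, (0 : ℝ) < √(P.weight j n) := fun n => Real.sqrt_pos.2 (P.weight_pos j n)
  have hw1 : ∀ n, (1 : ℝ) ≤ √(P.weight j n) := fun n => Real.one_le_sqrt.2 (P.one_le_weight j n)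
  have hc : Summable fun n => ‖c n‖ ^ 2 := by
    have := (lp.memℓp c).summable (by norm_num)
    simpa using this
  have hd : Memℓp (fun n => (√(P.weight j n) : 𝕜)⁻¹ * c n) 2 := by
    refine memℓp_gen ?_
    norm_num
    refine Summable.of_nonneg_of_le (fun n => by positivity) (fun n => ?_) hc
    refine pow_le_pow_left₀ (by positivity) ?_ 2
    rw [abs_of_pos (hw n)]
    exact mul_le_of_le_one_left (norm_nonneg _) (inv_le_one_of_one_le₀ (hw1 n))
  set f : H := e.repr.symm ⟨_, hd⟩ with hf
  have hfn : ∀ n, ⟪e n, f⟫_𝕜 = (√(P.weight j n) : 𝕜)⁻¹ * c n := by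
    intro n
    rw [← e.repr_apply_apply, hf, LinearIsometryEquiv.apply_symm_apply]
  have hfmem : f ∈ weightedSubmodule P e j := by
    refine hc.congr fun n => ?_
    rw [hfn, norm_mul, norm_inv, RCLike.norm_ofReal, abs_of_pos (hw n), mul_pow, inv_pow,
      Real.sq_sqrt (P.weight_pos j n).le, mul_inv_cancel_left₀ (P.weight_pos j n).ne']
  refine ⟨⟨f, hfmem⟩, ?_⟩
  ext n
  change (√(P.weight j n) : 𝕜) * ⟪e n, f⟫_𝕜 = _
  rw [hfn, mul_inv_cancel_left₀]
  exact_mod_cast (hw n).ne'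

instance : CompleteSpace (WeightedSpace P e j) :=
  ((coords P e j).isometry.isUniformInducing.completeSpace_congr (coords_surjective P e j)).2
    inferInstance

end WeightedSpace

end Weighted

/-! ### The multivariate approximation problem -/

section Approximation

variable {𝕜 : Type u} {H : Type v} [RCLike 𝕜] [NormedAddCommGroup H] [InnerProductSpace 𝕜 H]
  [CompleteSpace H]

/-- The space `H_s = H ⊗ ⋯ ⊗ H` (`s` factors). -/
def target (𝕜 : Type u) (H : Type v) [RCLike 𝕜] [NormedAddCommGroup H] [InnerProductSpace 𝕜 H]
    [CompleteSpace H] (s : ℕ+) : HilbertSpace.{u, v} 𝕜 :=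
  HilbertSpace.tensorSeq (fun _ => ⟨H⟩) s.natPred

/-- The space `H_{s, a, b} = H_{a_1, b_1} ⊗ ⋯ ⊗ H_{a_s, b_s}`. -/
def source (P : Params) (e : HilbertBasis ℕ 𝕜 H) (s : ℕ+) : HilbertSpace.{u, v} 𝕜 :=
  HilbertSpace.tensorSeq (fun j => ⟨WeightedSpace P e j.succPNat⟩) s.natPred

/-- The embedding `APP_s : H_{s, a, b} → H_s`, i.e. the tensor product of the embeddings
`H_{a_j, b_j} → H`, `1 ≤ j ≤ s`. -/
def APP (P : Params) (e : HilbertBasis ℕ 𝕜 H) (s : ℕ+) :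
    (source P e s).carrier →L[𝕜] (target 𝕜 H s).carrier :=
  HilbertSpace.tensorSeqMap (E := fun j => ⟨WeightedSpace P e j.succPNat⟩) (F := fun _ => ⟨H⟩)
    (fun j => WeightedSpace.embed P e j.succPNat) s.natPred

/-- For some `C > 0`, the bound
`n(ε, APP_s) ≤ C * exp (t * (1 + log s) * (1 + log (1 + log ε⁻¹)))` holds for all `s ∈ ℕ` and all
`ε ∈ (0, 1)`. -/
def ECQPTBound (P : Params) (e : HilbertBasis ℕ 𝕜 H) (t : ℝ) : Prop :=
  ∃ C : ℝ, 0 < C ∧ ∀ (s : ℕ+) (ε : ℝ), 0 < ε → ε < 1 →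
    (infoComplexity (APP P e s) ε : ENNReal) ≤
      ENNReal.ofReal (C * Real.exp
        (t * (1 + Real.log s) * (1 + Real.log (1 + Real.log ε⁻¹))))

/-- EC-quasi-polynomial tractability. -/
def ECQPT (P : Params) (e : HilbertBasis ℕ 𝕜 H) : Prop :=
  ∃ t : ℝ, 0 < t ∧ ECQPTBound P e t

/-- The exponent `t*` of EC-QPT: the infimum of the admissible `t > 0`. -/
def ecqptExponent (P : Params) (e : HilbertBasis ℕ 𝕜 H) : EReal :=
  ⨅ (t : ℝ) (_ : 0 < t ∧ ECQPTBound P e t), (t : EReal)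

end Approximation

namespace Params

variable (P : Params)

/-- `B* = sup_s (∑_{j ≤ s} 1 / b_j) / (1 + log s)`. -/
def Bstar : EReal :=
  ⨆ s : ℕ+, (((∑ j ∈ Finset.Icc 1 s, (P.b j)⁻¹) / (1 + Real.log s) : ℝ) : EReal)

/-- `α = liminf_j (1 + log j) * log a_j / j`. -/
def alpha : EReal :=
  Filter.liminf (fun j : ℕ+ => (((1 + Real.log j) * Real.log (P.a j) / j : ℝ) : EReal))
    Filter.atTop

/-- `m_max = max_{k ≥ 1} m_k` (the sequence `m` is bounded). -/
def mmax : ℕ := sSup (P.m '' Set.Ici 1)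

end Params

end ECTract

end

/-!
The operator `APP s` is diagonal. The normalised basis vectors of the weighted spaces form
orthonormal bases, their elementary tensors form an orthonormal basis of the Hilbert tensor product
(`HasSingularValues.tensorSeqMap`), and `APP s` maps them to multiples of the corresponding tensors
of the `e n`. Its singular values are therefore `exp (-c * ∑ j, a_j * k(n_j) ^ b_j)` with
`ω = exp (-2 * c)`, indexed by `n ∈ ℕ ^ s` (`hasSingularValues_APP`). Since the information
complexity of an operator with a singular value decomposition is the number of singular values above
`ε` (`HasSingularValues.infoComplexity_le`, `HasSingularValues.le_infoComplexity`), writing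
`ε = exp (-c * x)` turns the theorem into a statement about the number `N s x` of multi-indices with
`∑ j, a_j * k(n_j) ^ b_j < x`.

Boxes of multi-indices bound `N s x` from below. If `m 0 ≥ 2`, there are at least `2 ^ s`
multi-indices of cost zero, so no quasi-polynomial bound holds. For fixed `s` and `x → ∞`, the box
`n_j < (x / (2 * s * a_j)) ^ (1 / b_j)`, where `k(n_j) ≤ n_j`, gives `B* ≤ t`. The box `k(n_j) ≤ 1` at level
`x = 2 * s * a_s` gives `s * log (1 + m 1) ≤ t * (1 + log s) * log a_s + o(s)`, that is
`α ≥ log (1 + m 1) / t`.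

Conversely, only the coordinates with `a_j < x` can be nonzero. If `D ≤ s` is the last of these,
then `log (N s x) ≤ D * log (1 + mmax) + ∑ j ≤ D, (log x - log a_j) / b_j`
(`infoComplexity_APP_le_exp`). Here the sum is at most `B* * (1 + log s) * (log x - log a_1)`, and
for `q < α` and large `D` one has `q * D ≤ (1 + log D) * log a_D ≤ (1 + log s) * log x`. So every
`t > B* + log (1 + mmax) / q` is admissible (`ecqptBound_of_lt`): the gap absorbs the lower order
terms for large `x`, and for small `x` the number `D` is bounded because `a_j → ∞`.
-/

namespace ECTract

open Filter Topology

/-! ### Singular value decompositions and the information complexity -/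

section SingularValues

variable {𝕜 F G : Type*} [RCLike 𝕜] [NormedAddCommGroup F] [InnerProductSpace 𝕜 F]
  [NormedAddCommGroup G] [InnerProductSpace 𝕜 G]

/-- `HasSingularValues T σ` says that `T` has a singular value decomposition `T (f i) = σ i • g i`
with `f` an orthonormal family with dense span and `g` an orthonormal family. The `σ i` are listed
with multiplicity and in no particular order. -/
def HasSingularValues {ι : Type*} (T : F →L[𝕜] G) (σ : ι → ℝ) : Prop :=
  ∃ (f : ι → F) (g : ι → G), Orthonormal 𝕜 f ∧ Orthonormal 𝕜 g ∧
    (Submodule.span 𝕜 (Set.range f)).topologicalClosure = ⊤ ∧ ∀ i, T (f i) = (σ i : 𝕜) • g i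

theorem HasSingularValues.comp_equiv {ι κ : Type*} {T : F →L[𝕜] G} {σ : ι → ℝ}
    (h : HasSingularValues T σ) (φ : κ ≃ ι) : HasSingularValues T (σ ∘ φ) := by
  obtain ⟨f, g, hf, hg, hd, hT⟩ := h
  refine ⟨f ∘ φ, g ∘ φ, hf.comp _ φ.injective, hg.comp _ φ.injective, ?_, fun i => hT _⟩
  rwa [φ.surjective.range_comp]

theorem norm_sq_sum_smul_of_orthonormal {ι : Type*} {v : ι → F} (hv : Orthonormal 𝕜 v) (c : ι → 𝕜)
    (s : Finset ι) : ‖∑ i ∈ s, c i • v i‖ ^ 2 = ∑ i ∈ s, ‖c i‖ ^ 2 := by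
  have h := hv.inner_sum c c s
  rw [inner_self_eq_norm_sq_to_K] at h
  have h2 : ((‖∑ i ∈ s, c i • v i‖ ^ 2 : ℝ) : 𝕜) = ((∑ i ∈ s, ‖c i‖ ^ 2 : ℝ) : 𝕜) := by
    push_cast
    rw [h]
    exact Finset.sum_congr rfl fun i _ => RCLike.conj_mul _
  exact_mod_cast h2

/-- An operator that is diagonal with entries of modulus at most `ε` has norm at most `ε`. -/
theorem norm_le_of_diagonal {ι : Type*} {T : F →L[𝕜] G} {f : ι → F} {g : ι → G} {τ : ι → ℝ} {ε : ℝ}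
    (hf : Orthonormal 𝕜 f) (hg : Orthonormal 𝕜 g)
    (hd : (Submodule.span 𝕜 (Set.range f)).topologicalClosure = ⊤)
    (hT : ∀ i, T (f i) = (τ i : 𝕜) • g i) (hε : 0 ≤ ε) (hτ : ∀ i, |τ i| ≤ ε) : ‖T‖ ≤ ε := by
  refine T.opNorm_le_bound hε fun x => ?_
  have hx : x ∈ closure (Submodule.span 𝕜 (Set.range f) : Set F) := by
    have : x ∈ (Submodule.span 𝕜 (Set.range f)).topologicalClosure := hd ▸ Submodule.mem_top
    exact this
  have hcl : IsClosed {x : F | ‖T x‖ ≤ ε * ‖x‖} :=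
    isClosed_le (by fun_prop) (by fun_prop)
  refine closure_minimal ?_ hcl hx
  intro y hy
  obtain ⟨c, rfl⟩ := Finsupp.mem_span_range_iff_exists_finsupp.1 hy
  change ‖T _‖ ≤ ε * ‖_‖
  rw [← sq_le_sq₀ (norm_nonneg _) (by positivity), mul_pow, Finsupp.sum, map_sum,
    norm_sq_sum_smul_of_orthonormal hf]
  simp only [map_smul, hT, smul_smul]
  rw [norm_sq_sum_smul_of_orthonormal hg, Finset.mul_sum]
  refine Finset.sum_le_sum fun i _ => ?_
  rw [norm_mul, mul_pow, RCLike.norm_ofReal, mul_comm]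
  gcongr
  exact hτ i

theorem bddBelow_range_norm_sub_linearAlgorithm (T : F →L[𝕜] G) (n : ℕ) : BddBelow
    (Set.range fun A : (Fin n → F →L[𝕜] 𝕜) × (Fin n → G) => ‖T - linearAlgorithm A.1 A.2‖) :=
  ⟨0, by rintro _ ⟨A, rfl⟩; exact norm_nonneg _⟩

/-- Truncating the singular value decomposition to the singular values in a finite set `S` is a
linear algorithm, whose error is the supremum of the remaining singular values. -/
theorem HasSingularValues.infoComplexity_le {ι : Type*} {T : F →L[𝕜] G} {σ : ι → ℝ}
    (h : HasSingularValues T σ) {ε : ℝ} (hε : 0 ≤ ε) (S : Finset ι)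
    (hS : ∀ i, i ∉ S → |σ i| ≤ ε) : infoComplexity T ε ≤ S.card := by
  classical
  obtain ⟨f, g, hf, hg, hd, hT⟩ := h
  refine iInf₂_le_of_le S.card ?_ le_rfl
  let φ := S.equivFin.symm
  refine (ciInf_le (bddBelow_range_norm_sub_linearAlgorithm T S.card)
    (fun i => (σ (φ i) : 𝕜) • innerSL 𝕜 (f (φ i)), fun i => g (φ i))).trans ?_
  refine norm_le_of_diagonal (τ := fun i => if i ∈ S then 0 else σ i) hf hg hd (fun i => ?_) hε
    (fun i => ?_)
  · have hsum : linearAlgorithm (fun i => (σ (φ i) : 𝕜) • innerSL 𝕜 (f (φ i)))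
        (fun i => g (φ i)) (f i) = ∑ k ∈ S, ((σ k : 𝕜) * ⟪f k, f i⟫_𝕜) • g k := by
      rw [linearAlgorithm, sum_apply, ← Finset.sum_coe_sort S,
        ← Equiv.sum_comp φ]
      rfl
    rw [sub_apply, hsum, hT]
    simp only [orthonormal_iff_ite.1 hf]
    by_cases hi : i ∈ S
    · simp [hi]
    · simp [hi]
  · split_ifs with hi
    · simpa using hε
    · exact hS i hi

/-- An algorithm using fewer functionals than there are singular values above `ε` vanishes at some
nonzero vector of the span of the corresponding `f i`, where `T` is larger than `ε`. -/
theorem HasSingularValues.le_infoComplexity {ι : Type*} {T : F →L[𝕜] G} {σ : ι → ℝ}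
    (h : HasSingularValues T σ) {ε : ℝ} (hε : 0 ≤ ε) (S : Finset ι)
    (hS : ∀ i ∈ S, ε < σ i) : S.card ≤ infoComplexity T ε := by
  classical
  obtain ⟨f, g, hf, hg, -, hT⟩ := h
  refine le_iInf₂ fun n hn => ?_
  by_contra! hlt
  have hlt : n < S.card := by exact_mod_cast hlt
  obtain ⟨i₀, hi₀, hmin⟩ := S.exists_min_image σ (Finset.card_pos.1 (by omega))
  refine absurd hn (not_le.2 ((hS i₀ hi₀).trans_le (le_ciInf fun A => ?_)))
  -- `M c` lists the values at `∑ i, c i • f i` of the `n < #S` functionals of the algorithm.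
  let M : (S → 𝕜) →ₗ[𝕜] (Fin n → 𝕜) := LinearMap.pi fun k =>
    (A.1 k).toLinearMap ∘ₗ Fintype.linearCombination 𝕜 (fun i : S => f i)
  obtain ⟨c, hcM, hc⟩ := Submodule.exists_mem_ne_zero_of_ne_bot
    (LinearMap.ker_ne_bot_of_finrank_lt (f := M) (by simpa using hlt))
  have hfS : Orthonormal 𝕜 fun i : S => f i := hf.comp _ Subtype.val_injective
  have hgS : Orthonormal 𝕜 fun i : S => g i := hg.comp _ Subtype.val_injective
  set x : F := ∑ i : S, c i • f i with hx
  have hAx : linearAlgorithm A.1 A.2 x = 0 := by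
    rw [linearAlgorithm, sum_apply]
    refine Finset.sum_eq_zero fun k _ => ?_
    have : A.1 k x = 0 := congrFun (LinearMap.mem_ker.1 hcM) k
    simp [this]
  have hσ : 0 ≤ σ i₀ := hε.trans (hS i₀ hi₀).le
  have hTx : σ i₀ * ‖x‖ ≤ ‖T x‖ := by
    rw [← sq_le_sq₀ (by positivity) (norm_nonneg _), mul_pow, hx, map_sum,
      norm_sq_sum_smul_of_orthonormal hfS]
    simp only [map_smul, hT, smul_smul]
    rw [norm_sq_sum_smul_of_orthonormal hgS, Finset.mul_sum]
    refine Finset.sum_le_sum fun i _ => ?_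
    rw [norm_mul, mul_pow, RCLike.norm_ofReal, mul_comm]
    have := hmin i i.2
    gcongr
    exact this.trans (le_abs_self _)
  have hx0 : 0 < ‖x‖ := by
    have h2 := norm_sq_sum_smul_of_orthonormal hfS c Finset.univ
    obtain ⟨i, hi⟩ := Function.ne_iff.1 hc
    have h3 : ‖c i‖ ^ 2 ≤ ∑ i : S, ‖c i‖ ^ 2 :=
      Finset.single_le_sum (f := fun i => ‖c i‖ ^ 2) (fun i _ => sq_nonneg _) (Finset.mem_univ i)
    have h4 : 0 < ‖c i‖ := norm_pos_iff.2 hi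
    rw [← h2] at h3
    have : 0 < ‖x‖ ^ 2 := lt_of_lt_of_le (by positivity) h3
    exact (sq_pos_iff.1 this).lt_of_le' (norm_nonneg x)
  refine le_of_mul_le_mul_right (hTx.trans ?_) hx0
  have := (T - linearAlgorithm A.1 A.2).le_opNorm x
  rwa [sub_apply, hAx, sub_zero] at this

end SingularValues

/-! ### Singular values of tensor products -/

section TensorProducts

universe u v

variable {𝕜 : Type u} [RCLike 𝕜]

theorem orthonormal_tmul_completion {ι κ : Type*} {E F : HilbertSpace.{u, v} 𝕜}
    {f : ι → E.carrier} {g : κ → F.carrier}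
    (hf : Orthonormal 𝕜 f) (hg : Orthonormal 𝕜 g) :
    Orthonormal 𝕜 (E := UniformSpace.Completion (E.carrier ⊗[𝕜] F.carrier)) fun p : ι × κ =>
      ((f p.1 ⊗ₜ[𝕜] g p.2 : E.carrier ⊗[𝕜] F.carrier) :
        UniformSpace.Completion (E.carrier ⊗[𝕜] F.carrier)) := by
  classical
  rw [orthonormal_iff_ite] at *
  rintro ⟨i, k⟩ ⟨i', k'⟩
  rw [UniformSpace.Completion.inner_coe, TensorProduct.inner_tmul, hf, hg]
  simp only [Prod.mk.injEq]
  by_cases h1 : i = i' <;> by_cases h2 : k = k' <;> simp [h1, h2]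

theorem topologicalClosure_span_tmul_completion {ι κ : Type*} {E F : HilbertSpace.{u, v} 𝕜}
    {f : ι → E.carrier} {g : κ → F.carrier}
    (hf : (Submodule.span 𝕜 (Set.range f)).topologicalClosure = ⊤)
    (hg : (Submodule.span 𝕜 (Set.range g)).topologicalClosure = ⊤) :
    (Submodule.span 𝕜 (Set.range fun p : ι × κ =>
      ((f p.1 ⊗ₜ[𝕜] g p.2 : E.carrier ⊗[𝕜] F.carrier) :
        UniformSpace.Completion (E.carrier ⊗[𝕜] F.carrier)))).topologicalClosure = ⊤ := by
  set K := (Submodule.span 𝕜 (Set.range fun p : ι × κ =>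
      ((f p.1 ⊗ₜ[𝕜] g p.2 : E.carrier ⊗[𝕜] F.carrier) :
        UniformSpace.Completion (E.carrier ⊗[𝕜] F.carrier)))).topologicalClosure with hK
  have hKc : IsClosed (K : Set (UniformSpace.Completion (E.carrier ⊗[𝕜] F.carrier))) :=
    Submodule.isClosed_topologicalClosure _
  have hcoe := UniformSpace.Completion.continuous_coe (E.carrier ⊗[𝕜] F.carrier)
  let J : E.carrier ⊗[𝕜] F.carrier →L[𝕜] UniformSpace.Completion (E.carrier ⊗[𝕜] F.carrier) :=
    UniformSpace.Completion.toComplL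
  have h1 : ∀ x k, J (x ⊗ₜ[𝕜] g k) ∈ K := by
    intro x k
    let L := J.comp ((TensorProduct.mkL 𝕜 E.carrier F.carrier).flip (g k))
    have hle : (Submodule.span 𝕜 (Set.range f)).topologicalClosure ≤ K.comap L.toLinearMap := by
      refine Submodule.topologicalClosure_minimal _ (Submodule.span_le.2 ?_)
        (hKc.preimage L.continuous)
      rintro _ ⟨i, rfl⟩
      exact Submodule.le_topologicalClosure _ (Submodule.subset_span ⟨(i, k), rfl⟩)
    rw [hf] at hle
    exact hle (Submodule.mem_top (x := x))
  have h2 : ∀ x y, J (x ⊗ₜ[𝕜] y) ∈ K := by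
    intro x y
    let L := J.comp (TensorProduct.mkL 𝕜 E.carrier F.carrier x)
    have hle : (Submodule.span 𝕜 (Set.range g)).topologicalClosure ≤ K.comap L.toLinearMap := by
      refine Submodule.topologicalClosure_minimal _ (Submodule.span_le.2 ?_)
        (hKc.preimage L.continuous)
      rintro _ ⟨k, rfl⟩
      exact h1 x k
    rw [hg] at hle
    exact hle (Submodule.mem_top (x := y))
  have h3 : ∀ z, J z ∈ K := fun z => by
    induction z with
    | zero => rw [map_zero]; exact K.zero_mem
    | tmul x y => exact h2 x y
    | add z w hz hw => rw [map_add]; exact K.add_mem hz hw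
  refine Submodule.eq_top_iff'.2 fun z => ?_
  induction z using UniformSpace.Completion.induction_on with
  | hp => exact hKc
  | ih z => exact h3 z

theorem HasSingularValues.tensorMap {ι κ : Type*} {E E' F F' : HilbertSpace.{u, v} 𝕜}
    {S : E.carrier →L[𝕜] E'.carrier} {T : F.carrier →L[𝕜] F'.carrier} {σ : ι → ℝ} {τ : κ → ℝ}
    (hS : HasSingularValues S σ) (hT : HasSingularValues T τ) :
    HasSingularValues (HilbertSpace.tensorMap S T) fun p : ι × κ => σ p.1 * τ p.2 := by
  obtain ⟨f, f', hf, hf', hfd, hfS⟩ := hS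
  obtain ⟨g, g', hg, hg', hgd, hgT⟩ := hT
  refine ⟨_, _, orthonormal_tmul_completion hf hg, orthonormal_tmul_completion hf' hg',
    topologicalClosure_span_tmul_completion hfd hgd, fun p => ?_⟩
  refine (HilbertSpace.tensorMap_coe S T (f p.1) (g p.2)).trans ?_
  rw [hfS, hgT, TensorProduct.smul_tmul_smul, UniformSpace.Completion.coe_smul]
  push_cast
  rfl

theorem HasSingularValues.tensorSeqMap {E F : ℕ → HilbertSpace.{u, v} 𝕜}
    {T : ∀ j, (E j).carrier →L[𝕜] (F j).carrier} {ι : Type*} {σ : ℕ → ι → ℝ}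
    (h : ∀ j, HasSingularValues (T j) (σ j)) (n : ℕ) :
    HasSingularValues (HilbertSpace.tensorSeqMap T n)
      fun k : Fin (n + 1) → ι => ∏ j : Fin (n + 1), σ j (k j) := by
  induction n with
  | zero =>
    have heq : (fun k : Fin (0 + 1) → ι => ∏ j : Fin (0 + 1), σ j (k j)) =
        σ 0 ∘ Equiv.funUnique (Fin 1) ι := funext fun k => Fin.prod_univ_one _
    rw [heq]
    exact (h 0).comp_equiv _
  | succ n ih =>
    have heq : (fun k : Fin (n + 1 + 1) → ι => ∏ j : Fin (n + 1 + 1), σ j (k j)) =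
        (fun p : (Fin (n + 1) → ι) × ι => (∏ j : Fin (n + 1), σ j (p.1 j)) * σ (n + 1) p.2) ∘
          (Fin.snocEquiv fun _ => ι).symm.trans (Equiv.prodComm _ _) :=
      funext fun k => Fin.prod_univ_castSucc _
    rw [heq]
    exact (ih.tensorMap (h (n + 1))).comp_equiv _

end TensorProducts

/-! ### The information complexity of `APP` as a count -/

@[to_additive]
theorem prod_fin_succPNat {M : Type*} [CommMonoid M] (g : ℕ+ → M) (s : ℕ+) :
    ∏ j : Fin (s.natPred + 1), g (j : ℕ).succPNat = ∏ j ∈ Finset.Icc 1 s, g j := by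
  refine Finset.prod_nbij (fun j => (j : ℕ).succPNat) (fun j _ => ?_) (fun i _ j _ h => ?_)
    (fun j hj => ?_) fun _ _ => rfl
  · have h1 := j.2
    have h2 := s.natPred_add_one
    refine Finset.mem_Icc.2 ⟨one_le, PNat.coe_le_coe _ _ |>.1 ?_⟩
    rw [Nat.succPNat_coe]
    omega
  · exact Fin.ext (Nat.succPNat_injective h)
  · have h2 := s.natPred_add_one
    have h3 := j.natPred_add_one
    have h4 : (j : ℕ) ≤ s := PNat.coe_le_coe _ _ |>.2 (Finset.mem_Icc.1 hj).2
    exact ⟨⟨j.natPred, by omega⟩, by simp, by simp⟩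

namespace Params

variable (P : Params)

/-- The rate `c` with `ω = exp (-2 * c)`: the singular values of `APP` are `exp (-c * x)`, with `x`
running through the sums `∑ j, a_j * k_j ^ b_j`. -/
noncomputable def rate : ℝ := -Real.log P.ω / 2

theorem rate_pos : 0 < P.rate := by
  have := Real.log_neg P.ω_pos P.ω_lt_one
  unfold rate
  linarith

theorem inv_sqrt_weight (j : ℕ+) (n : ℕ) :
    (√(P.weight j n))⁻¹ = Real.exp (-(P.rate * (P.a j * (P.block n : ℝ) ^ P.b j))) := by
  rw [weight, Real.rpow_def_of_pos P.ω_pos, ← Real.exp_half, ← Real.exp_neg, rate]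
  congr 1
  ring

end Params

section

variable {𝕜 H : Type*} [RCLike 𝕜] [NormedAddCommGroup H] [InnerProductSpace 𝕜 H]

theorem hasSingularValues_embed (P : Params) (e : HilbertBasis ℕ 𝕜 H) (j : ℕ+) :
    HasSingularValues (WeightedSpace.embed P e j)
      fun n => Real.exp (-(P.rate * (P.a j * (P.block n : ℝ) ^ P.b j))) := by
  let B : HilbertBasis ℕ 𝕜 (WeightedSpace P e j) := HilbertBasis.ofRepr
    (LinearIsometryEquiv.ofSurjective (WeightedSpace.coords P e j)
      (WeightedSpace.coords_surjective P e j))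
  refine ⟨B, e, B.orthonormal, e.orthonormal, B.dense_span, fun n => ?_⟩
  dsimp only
  rw [← P.inv_sqrt_weight]
  refine e.repr.injective (lp.ext (funext fun m => ?_))
  have hw : ((√(P.weight j m) : ℝ) : 𝕜) ≠ 0 := by
    exact_mod_cast (Real.sqrt_pos.2 (P.weight_pos j m)).ne'
  have h1 : B.repr (B n) m = (√(P.weight j m) : 𝕜) * ⟪e m, WeightedSpace.incl P e j (B n)⟫_𝕜 := rfl
  rw [e.repr_apply_apply, e.repr_apply_apply, inner_smul_right,
    orthonormal_iff_ite.1 e.orthonormal]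
  rw [B.repr_apply_apply, orthonormal_iff_ite.1 B.orthonormal] at h1
  change ⟪e m, WeightedSpace.incl P e j (B n)⟫_𝕜 = _
  by_cases hmn : m = n
  · subst hmn
    rw [if_pos rfl] at h1 ⊢
    push_cast
    field_simp
    rw [h1, mul_comm]
  · rw [if_neg hmn] at h1 ⊢
    rw [mul_zero]
    exact (mul_eq_zero.1 h1.symm).resolve_left hw

variable [CompleteSpace H]

theorem hasSingularValues_APP (P : Params) (e : HilbertBasis ℕ 𝕜 H) (s : ℕ+) :
    HasSingularValues (APP P e s) fun n : Fin (s.natPred + 1) → ℕ =>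
      Real.exp (-(P.rate * ∑ j : Fin (s.natPred + 1), P.a (j : ℕ).succPNat *
        (P.block (n j) : ℝ) ^ P.b (j : ℕ).succPNat)) := by
  have h := HasSingularValues.tensorSeqMap (E := fun j => ⟨WeightedSpace P e j.succPNat⟩)
    (F := fun _ => ⟨H⟩) (T := fun j => WeightedSpace.embed P e j.succPNat)
    (fun j => hasSingularValues_embed P e j.succPNat) s.natPred
  simp only [← Real.exp_sum, Finset.sum_neg_distrib, ← Finset.mul_sum] at h
  exact h

/-- Every multi-index in the box `∏ j, [0, N j)` contributes a singular value above `exp (-c * x)`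
if the box lies in `∑ j, a_j * k_j ^ b_j < x`. -/
theorem prod_le_infoComplexity_APP (P : Params) (e : HilbertBasis ℕ 𝕜 H) (s : ℕ+) {x : ℝ}
    (N : ℕ+ → ℕ) (y : ℕ+ → ℝ)
    (hN : ∀ j ≤ s, ∀ n < N j, P.a j * (P.block n : ℝ) ^ P.b j ≤ y j)
    (hx : ∑ j ∈ Finset.Icc 1 s, y j < x) :
    ((∏ j ∈ Finset.Icc 1 s, N j : ℕ) : ℕ∞) ≤
      infoComplexity (APP P e s) (Real.exp (-(P.rate * x))) := by
  have h := (hasSingularValues_APP P e s).le_infoComplexity (Real.exp_pos (-(P.rate * x))).le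
    (Fintype.piFinset fun j : Fin (s.natPred + 1) => Finset.range (N (j : ℕ).succPNat)) ?_
  · rw [Fintype.card_piFinset] at h
    simpa only [Finset.card_range, prod_fin_succPNat] using h
  · intro n hn
    rw [Real.exp_lt_exp, neg_lt_neg_iff, mul_lt_mul_iff_right₀ P.rate_pos]
    refine lt_of_le_of_lt ?_ hx
    rw [← sum_fin_succPNat]
    refine Finset.sum_le_sum fun j _ => hN _ ?_ _ (Finset.mem_range.1 (Fintype.mem_piFinset.1 hn j))
    refine PNat.coe_le_coe _ _ |>.1 ?_
    have h1 := j.2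
    have h2 := s.natPred_add_one
    rw [Nat.succPNat_coe]
    omega

/-- The multi-indices with `∑ j, a_j * k_j ^ b_j < x` lie in the box of those with
`a_j * k_j ^ b_j < x` for every `j`. -/
theorem infoComplexity_APP_le_prod (P : Params) (e : HilbertBasis ℕ 𝕜 H) (s : ℕ+) {x : ℝ}
    (N : ℕ+ → ℕ) (hN : ∀ j n, P.a j * (P.block n : ℝ) ^ P.b j < x → n < N j) :
    infoComplexity (APP P e s) (Real.exp (-(P.rate * x))) ≤
      ((∏ j ∈ Finset.Icc 1 s, N j : ℕ) : ℕ∞) := by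
  have h := (hasSingularValues_APP P e s).infoComplexity_le (Real.exp_pos (-(P.rate * x))).le
    (Fintype.piFinset fun j : Fin (s.natPred + 1) => Finset.range (N (j : ℕ).succPNat)) ?_
  · rw [Fintype.card_piFinset] at h
    simpa only [Finset.card_range, prod_fin_succPNat] using h
  · intro n hn
    rw [abs_of_pos (Real.exp_pos _), Real.exp_le_exp, neg_le_neg_iff,
      mul_le_mul_iff_right₀ P.rate_pos]
    by_contra! hlt
    refine hn (Fintype.mem_piFinset.2 fun j => Finset.mem_range.2 (hN _ _ (lt_of_le_of_lt ?_ hlt)))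
    refine Finset.single_le_sum (f := fun j : Fin (s.natPred + 1) => P.a (j : ℕ).succPNat *
        (P.block (n j) : ℝ) ^ P.b (j : ℕ).succPNat) (fun j _ => ?_) (Finset.mem_univ j)
    exact mul_nonneg (P.a_pos _).le (by positivity)

/-- The tractability bound, with `ε` written as `exp (-c * x)`. -/
theorem ecqptBound_iff (P : Params) (e : HilbertBasis ℕ 𝕜 H) (t : ℝ) :
    ECQPTBound P e t ↔ ∃ C : ℝ, 0 < C ∧ ∀ (s : ℕ+) (x : ℝ), 0 < x →
      (infoComplexity (APP P e s) (Real.exp (-(P.rate * x))) : ENNReal) ≤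
        ENNReal.ofReal (C * Real.exp
          (t * (1 + Real.log s) * (1 + Real.log (1 + P.rate * x)))) := by
  refine exists_congr fun C => and_congr_right fun _ => forall_congr' fun s => ⟨fun h x hx => ?_,
    fun h ε h0 h1 => ?_⟩
  · have := h (Real.exp (-(P.rate * x))) (Real.exp_pos _)
      (Real.exp_lt_one_iff.2 (neg_lt_zero.2 (mul_pos P.rate_pos hx)))
    rwa [Real.log_inv, Real.log_exp, neg_neg] at this
  · have hc := P.rate_pos
    have hl : 0 < Real.log ε⁻¹ := Real.log_pos ((one_lt_inv₀ h0).2 h1)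
    have := h (Real.log ε⁻¹ / P.rate) (div_pos hl hc)
    rwa [mul_div_cancel₀ _ hc.ne', Real.log_inv, neg_neg, Real.exp_log h0, ← Real.log_inv] at this

end

/-! ### Blocks and elementary asymptotics -/

namespace Params

variable (P : Params)

theorem b_pos (j : ℕ+) : 0 < P.b j := by
  obtain ⟨β, hβ, h⟩ := P.b_bounded_below
  exact hβ.trans_le (h j)

theorem r_mono : Monotone P.r := fun _ _ h =>
  Finset.sum_le_sum_of_subset (Finset.range_mono h)

theorem block_le_self (n : ℕ) : P.block n ≤ n := Nat.findGreatest_le n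

theorem block_lt_of_lt_r {n k : ℕ} (h : n < P.r k) : P.block n < k := by
  by_contra! hk
  exact absurd ((P.r_mono hk).trans (P.block_spec n).1) (not_le.2 h)

theorem lt_r_of_block_lt {n k : ℕ} (h : P.block n < k) : n < P.r k :=
  (P.block_spec n).2.trans_le (P.r_mono h)

theorem m_le_mmax {k : ℕ} (hk : 1 ≤ k) : P.m k ≤ P.mmax := by
  obtain ⟨M, hM⟩ := P.m_bounded
  exact le_csSup ⟨M, by rintro _ ⟨i, _, rfl⟩; exact hM i⟩ ⟨k, hk, rfl⟩

theorem r_succ_le (hm : P.m 0 = 1) (k : ℕ) : P.r (k + 1) ≤ 1 + P.mmax * k := by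
  rw [r, Finset.sum_range_succ', hm, add_comm]
  have := Finset.sum_le_card_nsmul (Finset.range k) (fun i => P.m (i + 1)) P.mmax
    fun i _ => P.m_le_mmax (by omega)
  rw [Finset.card_range, smul_eq_mul, mul_comm] at this
  omega

end Params

theorem tendsto_log_quadratic_div_atTop (A B D : ℝ) :
    Tendsto (fun j : ℕ+ => (A + B * Real.log j + D * Real.log j ^ 2) / (j : ℝ)) atTop (𝓝 0) := by
  have h : ∀ n, Tendsto (fun x : ℝ => Real.log x ^ n / x) atTop (𝓝 0) := fun n =>
    (Real.isLittleO_pow_log_id_atTop (n := n)).tendsto_div_nhds_zero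
  have h2 := (((h 0).const_mul A).add ((h 1).const_mul B)).add ((h 2).const_mul D)
  have hc : Tendsto (fun j : ℕ+ => ((j : ℕ) : ℝ)) atTop atTop :=
    tendsto_natCast_atTop_atTop.comp tendsto_PNat_val_atTop_atTop
  refine (Tendsto.congr (fun j => ?_) (h2.comp hc)).trans (by simp)
  simp only [Function.comp, pow_zero, pow_one]
  ring

/-- An affine bound with slope `γ` for a linear function with slope `β`, valid on all of `[0, ∞)`,
forces `β ≤ γ`. -/
theorem slope_le_of_forall_mul_le {β γ K : ℝ} (h : ∀ u, 0 ≤ u → β * u ≤ K + γ * u) : β ≤ γ := by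
  by_contra! hlt
  have hpos : 0 < β - γ := sub_pos.2 hlt
  have := h ((|K| + 1) / (β - γ)) (by positivity)
  have h2 : (β - γ) * ((|K| + 1) / (β - γ)) = |K| + 1 := mul_div_cancel₀ _ hpos.ne'
  nlinarith [le_abs_self K]

/-! ### Necessary conditions -/

section Necessity

variable {𝕜 H : Type*} [RCLike 𝕜] [NormedAddCommGroup H] [InnerProductSpace 𝕜 H] [CompleteSpace H]
  {P : Params} {e : HilbertBasis ℕ 𝕜 H} {t : ℝ}

/-- A tractability bound limits the size of every box of multi-indices below level `x`. -/
theorem ECQPTBound.exists_sum_log_le (h : ECQPTBound P e t) :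
    ∃ K : ℝ, ∀ (s : ℕ+) (x : ℝ) (N : ℕ+ → ℕ) (y : ℕ+ → ℝ), 0 < x → (∀ j, 0 < N j) →
      (∀ j ≤ s, ∀ n < N j, P.a j * (P.block n : ℝ) ^ P.b j ≤ y j) →
      ∑ j ∈ Finset.Icc 1 s, y j < x →
      ∑ j ∈ Finset.Icc 1 s, Real.log (N j) ≤
        K + t * (1 + Real.log s) * (1 + Real.log (1 + P.rate * x)) := by
  obtain ⟨C, hC, h⟩ := (ecqptBound_iff P e t).1 h
  refine ⟨Real.log C, fun s x N y hx hN0 hN hy => ?_⟩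
  have h1 := (ENat.toENNReal_le.2 (prod_le_infoComplexity_APP P e s N y hN hy)).trans (h s x hx)
  rw [ENat.toENNReal_coe, ← ENNReal.ofReal_natCast, ENNReal.ofReal_le_ofReal_iff (by positivity)]
    at h1
  have hN0' : ∀ j, (0 : ℝ) < N j := fun j => Nat.cast_pos.2 (hN0 j)
  push_cast at h1
  have h2 := Real.log_le_log (Finset.prod_pos fun j _ => hN0' j) h1
  rwa [Real.log_prod fun j _ => (hN0' j).ne', Real.log_mul hC.ne' (Real.exp_pos _).ne',
    Real.log_exp] at h2

/-- If `m 0 ≥ 2`, then at least `2 ^ s` singular values of `APP s` equal `1`. -/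
theorem ECQPTBound.m_zero (h : ECQPTBound P e t) : P.m 0 = 1 := by
  obtain ⟨K, h⟩ := h.exists_sum_log_le
  by_contra hm
  have hm2 : 2 ≤ P.m 0 := by have := P.m_pos 0; omega
  have hlog : 0 < Real.log (P.m 0) := Real.log_pos (by exact_mod_cast hm2)
  -- Level `x = 1` is arbitrary: the box has cost zero.
  set T := t * (1 + Real.log (1 + P.rate * 1)) with hT
  have hlim := (tendsto_log_quadratic_div_atTop (K + T) T 0).eventually_lt_const hlog
  obtain ⟨s, hs⟩ := hlim.exists
  have h1 := h s 1 (fun _ => P.m 0) (fun _ => 0) one_pos (fun _ => P.m_pos 0) (fun j _ n hn => ?_)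
    (by simp)
  · have hs0 : (0 : ℝ) < s := by exact_mod_cast s.pos
    rw [div_lt_iff₀ hs0] at hs
    simp only [Finset.sum_const, PNat.card_Icc, PNat.one_coe, Nat.add_sub_cancel,
      nsmul_eq_mul] at h1
    rw [mul_comm] at h1
    linarith
  · have : P.block n = 0 := Nat.lt_one_iff.1 (P.block_lt_of_lt_r (by simpa [Params.r] using hn))
    simp [this, Real.zero_rpow (P.b_pos j).ne']

/-- For fixed `s`, the complexity grows at least like the power `∑ j ≤ s, 1 / b_j` of `x`. -/
theorem ECQPTBound.sum_inv_b_le (h : ECQPTBound P e t) (ht : 0 < t) (s : ℕ+) :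
    ∑ j ∈ Finset.Icc 1 s, (P.b j)⁻¹ ≤ t * (1 + Real.log s) := by
  have hs0 : (0 : ℝ) < s := by exact_mod_cast s.pos
  have hs1 : (1 : ℝ) ≤ s := by exact_mod_cast (one_le : 1 ≤ s)
  have hc := P.rate_pos
  have hlogs : 0 ≤ Real.log s := Real.log_nonneg hs1
  obtain ⟨K, h⟩ := h.exists_sum_log_le
  -- Take `x = exp u` and compare the slopes in `u`.
  refine slope_le_of_forall_mul_le
    (K := K + t * (1 + Real.log s) * (1 + Real.log (1 + P.rate)) +
      ∑ j ∈ Finset.Icc 1 s, (P.b j)⁻¹ * Real.log (2 * s * P.a j)) fun u hu => ?_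
  have hd : ∀ j, 0 < Real.exp u / (2 * s * P.a j) := fun j => by
    have := P.a_pos j
    positivity
  have hpow : ∀ j, 0 < (Real.exp u / (2 * s * P.a j)) ^ (P.b j)⁻¹ := fun j =>
    Real.rpow_pos_of_pos (hd j) _
  have h1 := h s (Real.exp u) (fun j => ⌈(Real.exp u / (2 * s * P.a j)) ^ (P.b j)⁻¹⌉₊)
    (fun _ => Real.exp u / (2 * s)) (Real.exp_pos u) (fun j => Nat.ceil_pos.2 (hpow j))
    (fun j _ n hn => ?_) ?_
  · have h2 : Real.log (1 + P.rate * Real.exp u) ≤ Real.log (1 + P.rate) + u := by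
      rw [← Real.log_exp u, ← Real.log_mul (by positivity) (Real.exp_pos _).ne', Real.log_exp]
      refine Real.log_le_log (by positivity) ?_
      have := Real.one_le_exp hu
      nlinarith
    have h3 : ∑ j ∈ Finset.Icc 1 s, ((P.b j)⁻¹ * u - (P.b j)⁻¹ * Real.log (2 * s * P.a j)) ≤
        K + t * (1 + Real.log s) * (1 + (Real.log (1 + P.rate) + u)) := by
      refine ((Finset.sum_le_sum fun j _ => ?_).trans h1).trans (by gcongr)
      have := P.a_pos j
      rw [← mul_sub, ← Real.log_exp u, ← Real.log_div (Real.exp_pos _).ne' (by positivity),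
        Real.log_exp, ← Real.log_rpow (hd j)]
      exact Real.log_le_log (hpow j) (Nat.le_ceil _)
    rw [Finset.sum_sub_distrib, ← Finset.sum_mul] at h3
    linarith
  · have ha := P.a_pos j
    have h4 : (P.block n : ℝ) ≤ (Real.exp u / (2 * s * P.a j)) ^ (P.b j)⁻¹ :=
      (Nat.cast_le.2 (P.block_le_self n)).trans (Nat.lt_ceil.1 hn).le
    rw [Real.le_rpow_inv_iff_of_pos (by positivity) (hd j).le (P.b_pos j),
      le_div_iff₀ (by positivity)] at h4
    rw [le_div_iff₀ (by positivity)]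
    linarith
  · simp only [Finset.sum_const, PNat.card_Icc, PNat.one_coe, Nat.add_sub_cancel, nsmul_eq_mul]
    have := Real.exp_pos u
    rw [mul_div_assoc', div_lt_iff₀ (by positivity)]
    nlinarith [mul_pos hs0 this]

/-- At level `x > ∑ j ≤ s, a_j`, all `(1 + m 1) ^ s` multi-indices with blocks in `{0, 1}` count. -/
theorem ECQPTBound.log_div_le_alpha (h : ECQPTBound P e t) (ht : 0 < t) :
    ((Real.log (1 + P.m 1) / t : ℝ) : EReal) ≤ P.alpha := by
  have hm := h.m_zero
  obtain ⟨K, h⟩ := h.exists_sum_log_le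
  have hc := P.rate_pos
  have ha := P.a_one_pos
  set κ := Real.log ((P.a 1)⁻¹ + 2 * P.rate) with hκ
  have hlim := tendsto_log_quadratic_div_atTop (K / t + (1 + κ)) (2 + κ) 1
  refine EReal.ge_of_forall_gt_iff_ge.1 fun q hq => le_liminf_of_le (h := ?_)
  have hq : q < Real.log (1 + P.m 1) / t := by exact_mod_cast hq
  filter_upwards [hlim.eventually_lt_const (sub_pos.2 hq)] with s hs
  have hs0 : (0 : ℝ) < s := by exact_mod_cast s.pos
  have hs1 : (1 : ℝ) ≤ s := by exact_mod_cast (one_le : 1 ≤ s)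
  have hlogs : 0 ≤ Real.log s := Real.log_nonneg hs1
  have has := P.a_pos s
  have h1 := h s (2 * (s * P.a s)) (fun _ => 1 + P.m 1) P.a (by positivity) (fun _ => by omega)
    (fun j _ n hn => ?_) ?_
  · simp only [Finset.sum_const, PNat.card_Icc, PNat.one_coe, Nat.add_sub_cancel,
      nsmul_eq_mul] at h1
    push_cast at h1
    have h2 : Real.log (1 + P.rate * (2 * (s * P.a s))) ≤ Real.log s + Real.log (P.a s) + κ := by
      rw [hκ, ← Real.log_mul hs0.ne' has.ne', ← Real.log_mul (by positivity) (by positivity)]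
      refine Real.log_le_log (by positivity) ?_
      have : 1 ≤ s * P.a s * (P.a 1)⁻¹ := by
        rw [← div_eq_mul_inv, one_le_div ha]
        have := P.a_mono (one_le : 1 ≤ s)
        nlinarith
      nlinarith
    have h3 : s * Real.log (1 + P.m 1) ≤ K + t * (1 + Real.log s) *
        (1 + (Real.log s + Real.log (P.a s) + κ)) := h1.trans (by gcongr)
    rw [div_lt_iff₀ hs0] at hs
    have h4 : q ≤ (1 + Real.log s) * Real.log (P.a s) / s := by
      rw [le_div_iff₀ hs0]
      have h5 : Real.log (1 + P.m 1) / t * s ≤ K / t + (1 + Real.log s) *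
          (1 + (Real.log s + Real.log (P.a s) + κ)) := by
        rw [div_mul_eq_mul_div, div_le_iff₀ ht, add_mul, div_mul_cancel₀ _ ht.ne']
        linarith
      nlinarith
    exact_mod_cast h4
  · have hb : P.block n ≤ 1 := Nat.lt_succ_iff.1 (P.block_lt_of_lt_r
      (by simpa [Params.r, Finset.sum_range_succ, hm] using hn))
    have : (P.block n : ℝ) ^ P.b j ≤ 1 :=
      Real.rpow_le_one (by positivity) (by exact_mod_cast hb) (P.b_pos j).le
    exact mul_le_of_le_one_right (P.a_pos j).le this
  · have h6 := Finset.sum_le_card_nsmul (Finset.Icc 1 s) P.a (P.a s)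
      fun j hj => P.a_mono (Finset.mem_Icc.1 hj).2
    simp only [PNat.card_Icc, PNat.one_coe, Nat.add_sub_cancel, nsmul_eq_mul] at h6
    have : (0 : ℝ) < s * P.a s := by positivity
    linarith

end Necessity

/-! ### Sufficient conditions -/

section Sufficiency

variable {𝕜 H : Type*} [RCLike 𝕜] [NormedAddCommGroup H] [InnerProductSpace 𝕜 H] [CompleteSpace H]

/-- Only the `D` coordinates `j ≤ s` with `a j < x` can be nonzero, and for each of these there are
at most `(1 + mmax) * (x / a j) ^ (1 / b j)` choices. -/
theorem infoComplexity_APP_le_exp (P : Params) (e : HilbertBasis ℕ 𝕜 H) (hm : P.m 0 = 1) {B : ℝ}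
    (hB : ∀ s : ℕ+, ∑ j ∈ Finset.Icc 1 s, (P.b j)⁻¹ ≤ B * (1 + Real.log s)) (s : ℕ+) {x : ℝ} :
    infoComplexity (APP P e s) (Real.exp (-(P.rate * x))) ≤ 1 ∨ ∃ D ≤ s, P.a D < x ∧
      (infoComplexity (APP P e s) (Real.exp (-(P.rate * x))) : ENNReal) ≤
        ENNReal.ofReal (Real.exp (D * Real.log (1 + P.mmax) +
          B * (1 + Real.log D) * (Real.log x - Real.log (P.a 1)))) := by
  classical
  -- For `x ≤ a j` the index lies in block `0`, which has the single element `0` as `m 0 = 1`.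
  set N : ℕ+ → ℕ := fun j => if P.a j < x then P.r ⌈(x / P.a j) ^ (P.b j)⁻¹⌉₊ else 1 with hN
  have hbox : ∀ j n, P.a j * (P.block n : ℝ) ^ P.b j < x → n < N j := by
    intro j n h
    have ha := P.a_pos j
    simp only [hN]
    split_ifs with hj
    · refine P.lt_r_of_block_lt (Nat.lt_ceil.2 ?_)
      rw [Real.lt_rpow_inv_iff_of_pos (by positivity) (div_pos (ha.trans hj) ha).le (P.b_pos j),
        lt_div_iff₀ ha]
      linarith
    · have h0 : P.block n < 1 := by
        by_contra! hb
        have : (1 : ℝ) ≤ (P.block n : ℝ) ^ P.b j :=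
          Real.one_le_rpow (by exact_mod_cast hb) (P.b_pos j).le
        nlinarith
      simpa [Params.r, hm] using P.lt_r_of_block_lt h0
  have hle := infoComplexity_APP_le_prod P e s N hbox
  rw [← Finset.prod_filter_mul_prod_filter_not _ (fun j => P.a j < x) N,
    Finset.prod_eq_one (s := {j ∈ Finset.Icc 1 s | ¬ P.a j < x})
      (fun j hj => if_neg (Finset.mem_filter.1 hj).2), mul_one] at hle
  rcases Finset.eq_empty_or_nonempty {j ∈ Finset.Icc 1 s | P.a j < x} with hE | hE
  · left
    simpa [hE] using hle
  right
  set S := {j ∈ Finset.Icc 1 s | P.a j < x} with hS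
  have hDmem := Finset.mem_filter.1 (S.max'_mem hE)
  set D := S.max' hE with hD
  refine ⟨D, (Finset.mem_Icc.1 hDmem.1).2, hDmem.2, (ENat.toENNReal_le.2 hle).trans ?_⟩
  have hx1 : P.a 1 < x := (P.a_mono one_le).trans_lt hDmem.2
  have hx0 : 0 < x := P.a_one_pos.trans hx1
  have hlog : 0 < Real.log x - Real.log (P.a 1) := sub_pos.2 (Real.log_lt_log P.a_one_pos hx1)
  have hℓ : 0 ≤ Real.log (1 + P.mmax) := Real.log_nonneg (by simp)
  rw [ENat.toENNReal_coe, ← ENNReal.ofReal_natCast]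
  refine ENNReal.ofReal_le_ofReal ?_
  push_cast
  have hfac : ∀ j ∈ S, (N j : ℝ) ≤ Real.exp (Real.log (1 + P.mmax) +
      (P.b j)⁻¹ * (Real.log x - Real.log (P.a 1))) := by
    intro j hj
    have hj := (Finset.mem_filter.1 hj).2
    have ha := P.a_pos j
    have hy : 1 ≤ (x / P.a j) ^ (P.b j)⁻¹ :=
      Real.one_le_rpow ((one_le_div ha).2 hj.le) (inv_nonneg.2 (P.b_pos j).le)
    have hNj : N j = P.r ⌈(x / P.a j) ^ (P.b j)⁻¹⌉₊ := if_pos hj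
    obtain ⟨k, hk⟩ := Nat.exists_eq_add_one.2 (Nat.ceil_pos.2 (one_pos.trans_le hy))
    have hky : (k : ℝ) ≤ (x / P.a j) ^ (P.b j)⁻¹ := (Nat.lt_ceil.1 (by omega : k < _)).le
    have h1 : (N j : ℝ) ≤ 1 + P.mmax * k := by
      rw [hNj, hk]
      exact_mod_cast P.r_succ_le hm k
    have h2 : (N j : ℝ) ≤ (1 + P.mmax) * (x / P.a j) ^ (P.b j)⁻¹ := by
      have : (P.mmax : ℝ) * k ≤ P.mmax * (x / P.a j) ^ (P.b j)⁻¹ := by gcongr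
      linarith
    refine h2.trans ?_
    rw [Real.exp_add, Real.exp_log (by positivity)]
    gcongr
    rw [Real.rpow_def_of_pos (by positivity), Real.log_div hx0.ne' ha.ne', mul_comm]
    have := P.b_pos j
    have := Real.log_le_log P.a_one_pos (P.a_mono (one_le : 1 ≤ j))
    gcongr
  refine (Finset.prod_le_prod (fun _ _ => Nat.cast_nonneg _) hfac).trans ?_
  rw [← Real.exp_sum, Real.exp_le_exp]
  have hsub : S ⊆ Finset.Icc 1 D := fun j hj => Finset.mem_Icc.2 ⟨one_le, S.le_max' j hj⟩
  refine (Finset.sum_le_sum_of_subset_of_nonneg hsub fun j _ _ => ?_).trans ?_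
  · have := P.b_pos j
    positivity
  · rw [Finset.sum_add_distrib, ← Finset.sum_mul]
    have := hB D
    simp only [Finset.sum_const, PNat.card_Icc, PNat.one_coe, Nat.add_sub_cancel, nsmul_eq_mul]
    gcongr

theorem tendsto_log_a_atTop (P : Params) {q : ℝ} (hq : 0 < q)
    (hα : ∀ᶠ j : ℕ+ in atTop, q ≤ (1 + Real.log j) * Real.log (P.a j) / j) :
    Tendsto (fun j => Real.log (P.a j)) atTop atTop := by
  refine tendsto_atTop.2 fun A => ?_
  have hlim := tendsto_log_quadratic_div_atTop (1 * |A|) |A| 0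
  filter_upwards [hα, hlim.eventually_lt_const hq] with j h1 h2
  have hj0 : (0 : ℝ) < j := by exact_mod_cast j.pos
  have hj1 : (1 : ℝ) ≤ j := by exact_mod_cast (one_le : 1 ≤ j)
  have hlog := Real.log_nonneg hj1
  have h3 := (div_lt_div_iff_of_pos_right hj0).1 (h2.trans_le h1)
  have h4 : (1 + Real.log j) * |A| < (1 + Real.log j) * Real.log (P.a j) := by linarith
  exact (le_abs_self A).trans (lt_of_mul_lt_mul_left h4 (by positivity)).le

/-- Here `B` is an upper bound for `B*` and `q` an eventual lower bound for the sequence whose limit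
inferior is `α`. -/
theorem ecqptBound_of_lt (P : Params) (e : HilbertBasis ℕ 𝕜 H) (hm : P.m 0 = 1) {B q t : ℝ}
    (hB : ∀ s : ℕ+, ∑ j ∈ Finset.Icc 1 s, (P.b j)⁻¹ ≤ B * (1 + Real.log s)) (hq : 0 < q)
    (hα : ∀ᶠ j : ℕ+ in atTop, q ≤ (1 + Real.log j) * Real.log (P.a j) / j)
    (ht : B + Real.log (1 + P.mmax) / q < t) : ECQPTBound P e t := by
  have hc := P.rate_pos
  have hB0 : 0 ≤ B := by
    have h1 := hB 1
    rw [Finset.Icc_self, Finset.sum_singleton, PNat.one_coe, Nat.cast_one, Real.log_one, add_zero,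
      mul_one] at h1
    exact (inv_pos.2 (P.b_pos 1)).le.trans h1
  have hℓ : 0 ≤ Real.log (1 + P.mmax) := Real.log_nonneg (by simp)
  set ℓ := Real.log (1 + P.mmax) with hℓdef
  have ht0 : 0 < t := lt_of_le_of_lt (by positivity) ht
  set t' := B + ℓ / q with ht'
  obtain ⟨J₀, hJ₀⟩ := eventually_atTop.1 hα
  -- Beyond `X₀` the gap between `t'` and `t` absorbs the terms in `1 + log s` without `log x`.
  set κ := -(B * Real.log (P.a 1)) - t - t * Real.log P.rate with hκ
  set X₀ := Real.exp (|κ| / (t - t')) with hX₀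
  have hgap : 0 < t - t' := sub_pos.2 ht
  have hX₀1 : 1 ≤ X₀ := Real.one_le_exp (by positivity)
  -- Below `X₀` at most `J₁` coordinates are active.
  obtain ⟨J₁, hJ₁⟩ := eventually_atTop.1
    ((tendsto_log_a_atTop P hq hα).eventually_ge_atTop (Real.log X₀))
  set V := J₁ * ℓ + B * (1 + Real.log J₁) * |Real.log X₀ - Real.log (P.a 1)| with hV
  have hlogJ : ∀ j : ℕ+, 0 ≤ Real.log j := fun j =>
    Real.log_nonneg (by exact_mod_cast (one_le : 1 ≤ j))
  have hV0 : 0 ≤ V := by have := hlogJ J₁; positivity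
  refine (ecqptBound_iff P e t).2 ⟨Real.exp (J₀ * ℓ + V), Real.exp_pos _, fun s x hx => ?_⟩
  have hlogs := hlogJ s
  have hlog1 : 0 ≤ Real.log (1 + P.rate * x) := Real.log_nonneg (by nlinarith [mul_pos hc hx])
  have hJℓ : 0 ≤ J₀ * ℓ := by positivity
  rw [← Real.exp_add]
  rcases infoComplexity_APP_le_exp P e hm hB s (x := x) with h | ⟨D, hDs, hDx, h⟩
  · refine (ENat.toENNReal_le.2 h).trans ?_
    rw [ENat.toENNReal_one, ENNReal.one_le_ofReal]
    exact Real.one_le_exp (by positivity)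
  refine h.trans (ENNReal.ofReal_le_ofReal (Real.exp_le_exp.2 ?_))
  have hlogD := hlogJ D
  have hlogax : Real.log (P.a D) < Real.log x := Real.log_lt_log (P.a_pos D) hDx
  have hlog1D := Real.log_le_log P.a_one_pos (P.a_mono (one_le : 1 ≤ D))
  have hDpos : (0 : ℝ) < D := by exact_mod_cast D.pos
  have hlogDs : Real.log D ≤ Real.log s := Real.log_le_log hDpos (by exact_mod_cast hDs)
  rcases lt_or_ge x X₀ with hxX | hxX
  · have hDJ : D ≤ J₁ := by
      by_contra! hlt
      exact absurd (hlogax.trans (Real.log_lt_log hx hxX)) (not_lt.2 (hJ₁ D hlt.le))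
    have hDJ' : (D : ℝ) ≤ J₁ := by exact_mod_cast hDJ
    have h1 : D * ℓ + B * (1 + Real.log D) * (Real.log x - Real.log (P.a 1)) ≤ V := by
      have := Real.log_le_log hDpos hDJ'
      have := Real.log_lt_log hx hxX
      have hab := le_abs_self (Real.log X₀ - Real.log (P.a 1))
      rw [hV]
      have h2 : Real.log x - Real.log (P.a 1) ≤ |Real.log X₀ - Real.log (P.a 1)| := by linarith
      have h3 : 0 ≤ Real.log x - Real.log (P.a 1) := by linarith
      gcongr
    have : 0 ≤ t * (1 + Real.log s) * (1 + Real.log (1 + P.rate * x)) := by positivity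
    linarith
  · have hlogx : 0 ≤ Real.log x := Real.log_nonneg (hX₀1.trans hxX)
    have hD : (D : ℝ) ≤ J₀ + (1 + Real.log s) * Real.log x / q := by
      rcases lt_or_ge D J₀ with hlt | hge
      · have : (D : ℝ) ≤ J₀ := by exact_mod_cast hlt.le
        have : 0 ≤ (1 + Real.log s) * Real.log x / q := by positivity
        linarith
      · have h1 := (le_div_iff₀ hDpos).1 (hJ₀ D hge)
        have h2 : (1 + Real.log D) * Real.log (P.a D) ≤ (1 + Real.log s) * Real.log x :=
          mul_le_mul (by linarith) hlogax.le
            (pos_of_mul_pos_right ((mul_pos hq hDpos).trans_le h1) (by positivity)).le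
            (by positivity)
        have h3 : (D : ℝ) ≤ (1 + Real.log s) * Real.log x / q := by
          rw [le_div_iff₀ hq]
          linarith
        have : (0 : ℝ) ≤ J₀ := by positivity
        linarith
    have h1 : D * ℓ ≤ J₀ * ℓ + (1 + Real.log s) * (ℓ / q * Real.log x) := by
      refine (mul_le_mul_of_nonneg_right hD hℓ).trans_eq ?_
      ring
    have h2 : B * (1 + Real.log D) * (Real.log x - Real.log (P.a 1)) ≤
        (1 + Real.log s) * (B * (Real.log x - Real.log (P.a 1))) := by
      have h3 : 0 ≤ Real.log x - Real.log (P.a 1) := by linarith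
      rw [mul_comm B, mul_assoc]
      gcongr
    have h4 : Real.log P.rate + Real.log x ≤ Real.log (1 + P.rate * x) := by
      rw [← Real.log_mul hc.ne' hx.ne']
      exact Real.log_le_log (by positivity) (by linarith)
    have h5 : κ ≤ (t - t') * Real.log x := by
      have := Real.log_le_log (Real.exp_pos _) hxX
      rw [Real.log_exp, div_le_iff₀ hgap] at this
      linarith [le_abs_self κ]
    have h6 : ℓ / q * Real.log x + B * (Real.log x - Real.log (P.a 1)) ≤
        t * (1 + Real.log (1 + P.rate * x)) := by
      have := mul_le_mul_of_nonneg_left h4 ht0.le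
      rw [ht'] at h5
      linarith
    have h7 := mul_le_mul_of_nonneg_left h6 (by positivity : 0 ≤ 1 + Real.log s)
    linarith

end Sufficiency

/-! ### The exponent -/

section Exponent

variable {𝕜 H : Type*} [RCLike 𝕜] [NormedAddCommGroup H] [InnerProductSpace 𝕜 H] [CompleteSpace H]
  {P : Params} {e : HilbertBasis ℕ 𝕜 H}

theorem ECQPTBound.Bstar_le {t : ℝ} (h : ECQPTBound P e t) (ht : 0 < t) : P.Bstar ≤ t := by
  refine iSup_le fun s => EReal.coe_le_coe_iff.2 ?_
  have : 0 ≤ Real.log s := Real.log_nonneg (by exact_mod_cast (one_le : 1 ≤ s))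
  rw [div_le_iff₀ (by positivity)]
  exact h.sum_inv_b_le ht s

theorem log_one_add_m_one_pos (P : Params) : 0 < Real.log (1 + P.m 1) :=
  Real.log_pos (by have : (0 : ℝ) < P.m 1 := Nat.cast_pos.2 (P.m_pos 1)
                   linarith)

theorem ECQPTBound.alpha_pos {t : ℝ} (h : ECQPTBound P e t) (ht : 0 < t) : 0 < P.alpha :=
  lt_of_lt_of_le (EReal.coe_pos.2 (div_pos (log_one_add_m_one_pos P) ht)) (h.log_div_le_alpha ht)

theorem ECQPTBound.div_alpha_le {t : ℝ} (h : ECQPTBound P e t) (ht : 0 < t) :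
    ((Real.log (1 + P.m 1) : ℝ) : EReal) / P.alpha ≤ t := by
  have h1 := h.log_div_le_alpha ht
  have h0 := h.alpha_pos ht
  induction hα : P.alpha using EReal.rec with
  | bot => simp [hα] at h0
  | top => rw [EReal.div_top]; exact_mod_cast ht.le
  | coe a =>
    rw [hα] at h0 h1
    have h0 : 0 < a := by exact_mod_cast h0
    have h1 := (div_le_iff₀ ht).1 (EReal.coe_le_coe_iff.1 h1)
    rw [← EReal.coe_div, EReal.coe_le_coe_iff, div_le_iff₀ h0]
    linarith

theorem ecqptBound_of_Bstar_add_lt (hm : P.m 0 = 1) (hB : P.Bstar < ⊤) (hα : 0 < P.alpha) {t : ℝ}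
    (ht : P.Bstar + ((Real.log (1 + P.mmax) : ℝ) : EReal) / P.alpha < t) :
    0 < t ∧ ECQPTBound P e t := by
  have hℓ : 0 < Real.log (1 + P.mmax) := by
    refine (log_one_add_m_one_pos P).trans_le (Real.log_le_log (by positivity) ?_)
    have : (P.m 1 : ℝ) ≤ P.mmax := by exact_mod_cast P.m_le_mmax le_rfl
    linarith
  have hB1 : (((P.b 1)⁻¹ : ℝ) : EReal) ≤ P.Bstar := by
    refine le_trans ?_ (le_iSup _ 1)
    simp
  have hb := inv_pos.2 (P.b_pos 1)
  lift P.Bstar to ℝ using ⟨hB.ne, (lt_of_lt_of_le (EReal.bot_lt_coe _) hB1).ne'⟩ with B hBeq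
  have hB1 := EReal.coe_le_coe_iff.1 hB1
  have hBs : ∀ s : ℕ+, ∑ j ∈ Finset.Icc 1 s, (P.b j)⁻¹ ≤ B * (1 + Real.log s) := fun s => by
    have h1 : (((∑ j ∈ Finset.Icc 1 s, (P.b j)⁻¹) / (1 + Real.log s) : ℝ) : EReal) ≤ (B : EReal) :=
      hBeq ▸ le_iSup (fun s : ℕ+ =>
        (((∑ j ∈ Finset.Icc 1 s, (P.b j)⁻¹) / (1 + Real.log s) : ℝ) : EReal)) s
    have : 0 ≤ Real.log s := Real.log_nonneg (by exact_mod_cast (one_le : 1 ≤ s))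
    exact (div_le_iff₀ (by positivity)).1 (EReal.coe_le_coe_iff.1 h1)
  -- This form of the hypothesis covers `α = ⊤` as well and yields `q < α` with
  -- `B + log (1 + mmax) / q < t`.
  have key : B < t ∧ ((Real.log (1 + P.mmax) / (t - B) : ℝ) : EReal) < P.alpha := by
    induction hα' : P.alpha using EReal.rec with
    | bot => simp [hα'] at hα
    | top =>
      rw [hα', EReal.div_top, add_zero] at ht
      exact ⟨EReal.coe_lt_coe_iff.1 ht, EReal.coe_lt_top _⟩
    | coe a =>
      rw [hα'] at hα ht
      have hα : 0 < a := by exact_mod_cast hα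
      rw [← EReal.coe_div, ← EReal.coe_add, EReal.coe_lt_coe_iff] at ht
      have h1 := div_pos hℓ hα
      have h2 : B < t := by linarith
      refine ⟨h2, EReal.coe_lt_coe_iff.2 ?_⟩
      rw [div_lt_iff₀ (sub_pos.2 h2), mul_comm, ← div_lt_iff₀ hα]
      linarith
  obtain ⟨hBt, hlt⟩ := key
  refine ⟨hb.trans_le hB1 |>.trans hBt, ?_⟩
  obtain ⟨q, hq1, hq2⟩ := EReal.lt_iff_exists_real_btwn.1 hlt
  have hq1 := EReal.coe_lt_coe_iff.1 hq1
  have hq : 0 < q := (div_pos hℓ (sub_pos.2 hBt)).trans hq1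
  refine ecqptBound_of_lt P e hm hBs hq ?_ ?_
  · filter_upwards [eventually_lt_of_lt_liminf hq2] with j hj
    exact (EReal.coe_lt_coe_iff.1 hj).le
  · rw [div_lt_iff₀ (sub_pos.2 hBt), mul_comm, ← div_lt_iff₀ hq] at hq1
    linarith

theorem ecqpt_iff : ECQPT P e ↔ P.m 0 = 1 ∧ P.Bstar < ⊤ ∧ 0 < P.alpha := by
  refine ⟨fun ⟨t, ht, h⟩ => ⟨h.m_zero, (h.Bstar_le ht).trans_lt (EReal.coe_lt_top t),
    h.alpha_pos ht⟩, fun ⟨hm, hB, hα⟩ => ?_⟩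
  have hlt : P.Bstar + ((Real.log (1 + P.mmax) : ℝ) : EReal) / P.alpha < ⊤ := by
    refine EReal.add_lt_top hB.ne ?_
    induction hα' : P.alpha using EReal.rec with
    | bot => simp [hα'] at hα
    | top => simp
    | coe a => rw [← EReal.coe_div]; exact EReal.coe_ne_top _
  obtain ⟨t, ht, -⟩ := EReal.lt_iff_exists_real_btwn.1 hlt
  exact ⟨t, ecqptBound_of_Bstar_add_lt hm hB hα ht⟩

theorem max_le_ecqptExponent :
    max P.Bstar (((Real.log (1 + P.m 1) : ℝ) : EReal) / P.alpha) ≤ ecqptExponent P e :=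
  le_iInf₂ fun _ h => max_le (h.2.Bstar_le h.1) (h.2.div_alpha_le h.1)

theorem ecqptExponent_le (h : ECQPT P e) :
    ecqptExponent P e ≤ P.Bstar + ((Real.log (1 + P.mmax) : ℝ) : EReal) / P.alpha := by
  obtain ⟨hm, hB, hα⟩ := ecqpt_iff.1 h
  exact EReal.le_of_forall_lt_iff_le.1 fun t ht =>
    iInf₂_le t (ecqptBound_of_Bstar_add_lt hm hB hα ht)

end Exponent

end ECTract

theorem theorem8 {𝕜 H : Type*} [RCLike 𝕜] [NormedAddCommGroup H] [InnerProductSpace 𝕜 H]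
    [CompleteSpace H] (e : HilbertBasis ℕ 𝕜 H) (P : ECTract.Params) :
    (ECTract.ECQPT P e ↔ P.m 0 = 1 ∧ P.Bstar < ⊤ ∧ 0 < P.alpha) ∧
    (ECTract.ECQPT P e →
      max P.Bstar ((Real.log (1 + P.m 1) : ℝ) / P.alpha) ≤ ECTract.ecqptExponent P e ∧
      ECTract.ecqptExponent P e ≤ P.Bstar + (Real.log (1 + P.mmax) : ℝ) / P.alpha ∧
      (P.alpha = ⊤ → ECTract.ecqptExponent P e = P.Bstar)) := by
  refine ⟨ECTract.ecqpt_iff, fun h => ⟨ECTract.max_le_ecqptExponent, ECTract.ecqptExponent_le h,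
    fun hα => le_antisymm ?_ ((le_max_left _ _).trans ECTract.max_le_ecqptExponent)⟩⟩
  simpa [hα] using ECTract.ecqptExponent_le h
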